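/- Let $(\mathbf{B},\|\cdot\|)$ be a real separable Banach space with its Borel $\sigma$-algebra, let $0<p<2$, and let $X, X_1, X_2,\dots$ be i.i.d. $\mathbf{B}$-valued random variables on a probability space $(\Omega,\mathcal F,\mathbb P)$. Put $S_n=\sum_{i=1}^n X_i$ and $$\bar\beta=-\limsup_{t\to\infty}\frac1t\log\mathbb P(\log\|X\|>t)\in[0,\infty],\qquad \underline\beta=-\liminf_{t\to\infty}\frac1t\log\mathbb P(\log\|X\|>t)\in[0,\infty],$$ with the conventions $\log 0=-\infty$ and $(\pm\infty+y)/x=\pm\infty$ for real $x>0$ and $y$. If $S_n/n^{1/p}\to 0$ in probability, then for every $s>0$ $$\limsup_{n\to\infty}\frac{1}{\log n}\log\mathbb P\left(\|S_n\|>s\,n^{1/p}\right)=-\frac{\bar\beta-p}{p}$$ and $$\liminf_{n\to\infty}\frac{1}{\log n}\log\mathbb P\left(\|S_n\|>s\,n^{1/p}\right)=-\frac{\underline\beta-p}{p}.$$ Hence, for every $s>0$ and every $\hat\beta\in[-\infty,\infty]$, the limit $\lim_{n\to\infty}\frac{1}{\log n}\log\mathbb P(\|S_n\|>s\,n^{1/p})$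 exists in $[-\infty,\infty]$ and equals $-(\hat\beta-p)/p$ if and only if $\bar\beta=\underline\beta=\hat\beta$. -/

import Mathlib

open Filter Topology MeasureTheory ProbabilityTheory

/-- The function `t ↦ (1/t) log ℙ(log ‖X‖ > t)` with values in `[-∞, ∞]`, where `log 0 = -∞` for the
outer logarithm. Only its behaviour as `t → ∞` matters; for `t ≥ 0` the event `log ‖X‖ > t` does not
contain any `ω` with `X ω = 0`, under either convention `Real.log 0 = 0` or `log 0 = -∞`. -/
noncomputable def logTailRate {Ω B : Type*} [MeasurableSpace Ω] [NormedAddCommGroup B]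
    (μ : Measure Ω) (X : Ω → B) (t : ℝ) : EReal :=
  ((1 / t : ℝ) : EReal) * ENNReal.log (μ {ω | Real.log ‖X ω‖ > t})

/-- The upper logarithmic tail exponent `- limsup_{t → ∞} (1/t) log ℙ(log ‖X‖ > t)`. -/
noncomputable def upperTailExponent {Ω B : Type*} [MeasurableSpace Ω] [NormedAddCommGroup B]
    (μ : Measure Ω) (X : Ω → B) : EReal :=
  -limsup (fun t : ℝ => logTailRate μ X t) atTop

/-- The lower logarithmic tail exponent `- liminf_{t → ∞} (1/t) log ℙ(log ‖X‖ > t)`. -/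
noncomputable def lowerTailExponent {Ω B : Type*} [MeasurableSpace Ω] [NormedAddCommGroup B]
    (μ : Measure Ω) (X : Ω → B) : EReal :=
  -liminf (fun t : ℝ => logTailRate μ X t) atTop

/-- The partial sum of the first `n` terms of a sequence of random variables; the sequence is indexed
from `0`, so that `Y i` is the `(i + 1)`-st variable. -/
def partialSum {Ω B : Type*} [AddCommMonoid B] (Y : ℕ → Ω → B) (n : ℕ) (ω : Ω) : B :=
  ∑ i ∈ Finset.range n, Y i ω

/-- The expression `(1 / log n) log ℙ(‖S_n‖ > s n^{1/p})` with values in `[-∞, ∞]`, where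
`log 0 = -∞` for the outer logarithm. -/
noncomputable def logDeviationRate {Ω B : Type*} [MeasurableSpace Ω] [NormedAddCommGroup B]
    (μ : Measure Ω) (Y : ℕ → Ω → B) (p s : ℝ) (n : ℕ) : EReal :=
  ((1 / Real.log n : ℝ) : EReal) *
    ENNReal.log (μ {ω | ‖partialSum Y n ω‖ > s * (n : ℝ) ^ (1 / p)})

/-
Write `V` for the tail function of `‖X‖`. Both identities compare the polynomial orders of
`ℙ(‖S_n‖ > s n^{1/p})` and `n V(n^{1/p})`.

Lower bound: if one summand is larger than `2 s n^{1/p}` and the sum of the others is at most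
`s n^{1/p}`, then `‖S_n‖ > s n^{1/p}`. By the weak law the second condition has probability at least
`1/2`, so a Chung–Erdős second moment argument over the summands gives
`n V(2 s n^{1/p}) ≤ 8 ℙ(‖S_n‖ > s n^{1/p})`. In particular `n V(n^{1/p})` stays bounded, so
`X` is in weak `L^p`.

Upper bound: truncate the summands at `n^{1/p - ε}`, at the cost of a probability at most
`n V(n^{1/p - ε})`. Since `p < 2`, weak `L^p` bounds the truncated second moments, and the
exponential concentration of a Lipschitz function of independent bounded variables makes the
remaining error smaller than any power of `n`. The norm concentrates around its mean, and the mean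
is controlled by the weak law. Finally let `ε → 0`.
-/

section LimitComparison

variable {α β : Type*} {l : Filter α} {l' : Filter β} {u : α → EReal} {v : β → EReal}
  {N : α → β} {c c' : EReal}

theorem limsup_le_of_eventually_imp (hN : map N l = l')
    (himp : ∀ᶠ a in l, u a ≤ c → v (N a) ≤ c') (hu : limsup u l < c) : limsup v l' ≤ c' := by
  subst hN
  refine limsup_le_of_le (by isBoundedDefault) (eventually_map.2 ?_)
  filter_upwards [himp, eventually_lt_of_limsup_lt hu] with a ha hua using ha hua.le

theorem liminf_le_of_eventually_imp (hN : map N l = l')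
    (himp : ∀ᶠ a in l, u a ≤ c → v (N a) ≤ c') (hu : liminf u l < c) : liminf v l' ≤ c' := by
  subst hN
  refine liminf_le_of_frequently_le (frequently_map.2 ?_) (by isBoundedDefault)
  exact ((frequently_lt_of_liminf_lt (by isBoundedDefault) hu).and_eventually himp).mono
    fun a ha => ha.2 ha.1.le

/-- Surjectivity of `N` near `l'` is what makes the upper limits comparable; for the lower limits
alone it would be enough that `N` tends to `l'` along `l`. -/
theorem limsup_le_limsup_and_liminf_le_liminf
    (H : ∀ c c' : ℝ, c < c' →
      ∃ N : α → β, map N l = l' ∧ ∀ᶠ a in l, u a ≤ c → v (N a) ≤ c') :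
    limsup v l' ≤ limsup u l ∧ liminf v l' ≤ liminf u l := by
  constructor <;>
    refine EReal.le_of_forall_lt_iff_le.1 fun c' hc' => ?_ <;>
    obtain ⟨c, huc, hcc'⟩ := EReal.lt_iff_exists_real_btwn.1 hc' <;>
    obtain ⟨N, hN, himp⟩ := H c c' (EReal.coe_lt_coe_iff.1 hcc')
  · exact limsup_le_of_eventually_imp hN himp huc
  · exact liminf_le_of_eventually_imp hN himp huc

theorem tendsto_nhds_iff_limsup_eq_and_liminf_eq [l.NeBot] {b : EReal} :
    Tendsto u l (𝓝 b) ↔ limsup u l = b ∧ liminf u l = b :=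
  ⟨fun h => ⟨h.limsup_eq, h.liminf_eq⟩, fun h => tendsto_of_liminf_eq_limsup h.2 h.1⟩

end LimitComparison

/-- The exponent `-(β - p) / p` of the deviation probabilities of order `n ^ (1 / p)` that belongs
to the tail exponent `β` of the summands. -/
noncomputable def deviationExponent (p : ℝ) (β : EReal) : EReal :=
  -(β - (p : EReal)) / (p : EReal)

section DeviationExponent

variable {p : ℝ}

theorem deviationExponent_strictAnti (hp : 0 < p) : StrictAnti (deviationExponent p) := by
  intro x y hxy
  refine EReal.strictMono_div_right_of_pos (EReal.coe_pos.2 hp) (EReal.coe_ne_top p) ?_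
  exact EReal.neg_strictAnti
    (EReal.sub_lt_sub_of_lt_of_le hxy le_rfl (EReal.coe_ne_bot p) (EReal.coe_ne_top p))

theorem continuous_deviationExponent (hp : 0 < p) : Continuous (deviationExponent p) := by
  refine continuous_iff_continuousAt.2 fun x => ?_
  have hsub : ContinuousAt (fun x : EReal => x - (p : EReal)) x :=
    (EReal.continuousAt_add (p := (x, -(p : EReal))) (by simp) (by simp)).comp
      (f := fun x : EReal => (x, -(p : EReal))) (by fun_prop)
  refine (EReal.continuousAt_mul (p := (-(x - (p : EReal)), (p : EReal)⁻¹)) ?_ ?_ ?_ ?_).comp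
    (f := fun x : EReal => (-(x - (p : EReal)), (p : EReal)⁻¹)) (by fun_prop) <;>
    simp [hp.ne', ← EReal.coe_inv]

theorem deviationExponent_neg_limsup {α : Type*} {l : Filter α} [l.NeBot] (hp : 0 < p)
    (f : α → EReal) :
    deviationExponent p (-limsup f l) = limsup (fun a => deviationExponent p (-f a)) l := by
  rw [← EReal.liminf_neg]
  exact (deviationExponent_strictAnti hp).antitone.map_liminf_of_continuousAt _
    (continuous_deviationExponent hp).continuousAt

theorem deviationExponent_neg_liminf {α : Type*} {l : Filter α} [l.NeBot] (hp : 0 < p)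
    (f : α → EReal) :
    deviationExponent p (-liminf f l) = liminf (fun a => deviationExponent p (-f a)) l := by
  rw [← EReal.limsup_neg]
  exact (deviationExponent_strictAnti hp).antitone.map_limsup_of_continuousAt _
    (continuous_deviationExponent hp).continuousAt

theorem deviationExponent_neg_le_coe_iff (hp : 0 < p) {x : EReal} {c : ℝ} :
    deviationExponent p (-x) ≤ c ↔ x ≤ ((p * (c - 1) : ℝ) : EReal) := by
  have hc : (c : EReal) = deviationExponent p (-((p * (c - 1) : ℝ) : EReal)) := by
    rw [deviationExponent, ← EReal.coe_neg, ← EReal.coe_sub, ← EReal.coe_neg, ← EReal.coe_div]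
    congr 1
    field_simp
    ring
  rw [hc, (deviationExponent_strictAnti hp).le_iff_ge, EReal.neg_le_neg_iff]

end DeviationExponent

theorem one_div_log_mul_log_le_coe_iff {y : ℝ} (hy : 1 < y) {a : ENNReal} (ha : a ≠ ⊤) {c : ℝ} :
    ((1 / Real.log y : ℝ) : EReal) * ENNReal.log a ≤ c ↔ a.toReal ≤ y ^ c := by
  have hlog : 0 < Real.log y := Real.log_pos hy
  rcases eq_or_ne a 0 with rfl | h0
  · simp [EReal.coe_mul_bot_of_pos (one_div_pos.2 hlog), -one_div,
      Real.rpow_nonneg (zero_le_one.trans hy.le)]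
  · rw [ENNReal.log_pos_real h0 ha, ← EReal.coe_mul, EReal.coe_le_coe_iff, one_div,
      inv_mul_le_iff₀ hlog, Real.log_le_iff_le_exp (ENNReal.toReal_pos h0 ha),
      ← Real.rpow_def_of_pos (zero_lt_one.trans hy)]

section SecondMoment

variable {Ω ι : Type*} [MeasurableSpace Ω] {μ : Measure Ω} [IsFiniteMeasure μ]

theorem sq_integral_le_measureReal_mul_integral_sq {f : Ω → ℝ} {E : Set Ω}
    (hf : Integrable f μ) (hf_sq : Integrable (fun ω => f ω ^ 2) μ) (hfE : ∀ ω ∉ E, f ω = 0) :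
    (∫ ω, f ω ∂μ) ^ 2 ≤ μ.real E * ∫ ω, f ω ^ 2 ∂μ := by
  have hquad (c : ℝ) :
      0 ≤ (∫ ω, f ω ^ 2 ∂μ) * (c * c) + -2 * (∫ ω, f ω ∂μ) * c + μ.real E :=
    calc 0 ≤ ∫ ω in E, (c * f ω - 1) ^ 2 ∂μ := integral_nonneg fun ω => sq_nonneg _
      _ = ∫ ω in E, (c ^ 2 * f ω ^ 2 - 2 * c * f ω + 1) ∂μ := by
        congr with ω
        ring
      _ = c ^ 2 * (∫ ω in E, f ω ^ 2 ∂μ) - 2 * c * (∫ ω in E, f ω ∂μ) + μ.real E := by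
        have hsq := hf_sq.integrableOn (s := E).const_mul (c ^ 2)
        have hlin := hf.integrableOn (s := E).const_mul (2 * c)
        have hdiff : IntegrableOn (fun ω => c ^ 2 * f ω ^ 2 - 2 * c * f ω) E μ := hsq.sub hlin
        rw [integral_add hdiff (integrable_const _), integral_sub hsq hlin,
          integral_const_mul, integral_const_mul, setIntegral_const, smul_eq_mul, mul_one]
      _ = _ := by
        rw [setIntegral_eq_integral_of_forall_compl_eq_zero hfE,
          setIntegral_eq_integral_of_forall_compl_eq_zero fun ω hω => by simp [hfE ω hω]]
        ring
  have := discrim_le_zero hquad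
  rw [discrim] at this
  linarith

/-- The Chung–Erdős inequality. -/
theorem sq_sum_measureReal_le_measureReal_biUnion_mul (I : Finset ι) {D : ι → Set Ω}
    (hD : ∀ i, NullMeasurableSet (D i) μ) :
    (∑ i ∈ I, μ.real (D i)) ^ 2 ≤
      μ.real (⋃ i ∈ I, D i) * ∑ i ∈ I, ∑ j ∈ I, μ.real (D i ∩ D j) := by
  let count : Ω → ℝ := fun ω => ∑ i ∈ I, (D i).indicator 1 ω
  have hint {A : Set Ω} (hA : NullMeasurableSet A μ) : Integrable (A.indicator (1 : Ω → ℝ)) μ :=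
    (integrable_const (1 : ℝ)).indicator₀ hA
  have hintegral {A : Set Ω} (hA : NullMeasurableSet A μ) :
      ∫ ω, A.indicator (1 : Ω → ℝ) ω ∂μ = μ.real A := by simp [integral_indicator₀ hA]
  have hDD (i j) : NullMeasurableSet (D i ∩ D j) μ := (hD i).inter (hD j)
  have hcount_sq (ω) : count ω ^ 2 = ∑ i ∈ I, ∑ j ∈ I, (D i ∩ D j).indicator 1 ω := by
    simp only [count, sq, Finset.sum_mul_sum, ← Set.inter_indicator_mul, Pi.one_def, mul_one]
  have hcount_int : Integrable count μ := integrable_finsetSum I fun i _ => hint (hD i)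
  have hcount_sq_int : Integrable (fun ω => count ω ^ 2) μ := by
    simp_rw [hcount_sq]
    exact integrable_finsetSum I fun i _ => integrable_finsetSum I fun j _ => hint (hDD i j)
  have hcount_zero (ω) (hω : ω ∉ ⋃ i ∈ I, D i) : count ω = 0 :=
    Finset.sum_eq_zero fun i hi =>
      Set.indicator_of_notMem (fun h => hω (Set.mem_biUnion hi h)) _
  have hmean : ∫ ω, count ω ∂μ = ∑ i ∈ I, μ.real (D i) := by
    rw [integral_finsetSum I fun i _ => hint (hD i)]
    exact Finset.sum_congr rfl fun i _ => hintegral (hD i)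
  have hmean_sq : ∫ ω, count ω ^ 2 ∂μ = ∑ i ∈ I, ∑ j ∈ I, μ.real (D i ∩ D j) := by
    simp_rw [hcount_sq]
    rw [integral_finsetSum I fun i _ => integrable_finsetSum I fun j _ => hint (hDD i j)]
    refine Finset.sum_congr rfl fun i _ => ?_
    rw [integral_finsetSum I fun j _ => hint (hDD i j)]
    exact Finset.sum_congr rfl fun j _ => hintegral (hDD i j)
  rw [← hmean, ← hmean_sq]
  exact sq_integral_le_measureReal_mul_integral_sq hcount_int hcount_sq_int hcount_zero

theorem sq_mul_sum_measureReal_le_measureReal_biUnion (I : Finset ι)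
    {A D : ι → Set Ω} {q : ℝ} (hq : 0 ≤ q)
    (hA : ∀ i j, i ≠ j → μ.real (A i ∩ A j) = μ.real (A i) * μ.real (A j))
    (hD : ∀ i, NullMeasurableSet (D i) μ) (hDA : ∀ i, D i ⊆ A i)
    (hqD : ∀ i ∈ I, q * μ.real (A i) ≤ μ.real (D i)) :
    q ^ 2 * ∑ i ∈ I, μ.real (A i) ≤
      (1 + ∑ i ∈ I, μ.real (A i)) * μ.real (⋃ i ∈ I, D i) := by
  classical
  have hpair (i j) :
      μ.real (D i ∩ D j) ≤ (if i = j then μ.real (A i) else 0) + μ.real (A i) * μ.real (A j) := by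
    split_ifs with hij
    · have : μ.real (D i ∩ D j) ≤ μ.real (A i) :=
        measureReal_mono (Set.inter_subset_left.trans (hDA i))
      have : 0 ≤ μ.real (A i) * μ.real (A j) := by positivity
      linarith
    · rw [zero_add, ← hA i j hij]
      exact measureReal_mono (Set.inter_subset_inter (hDA i) (hDA j))
  set v := ∑ i ∈ I, μ.real (A i) with hv_def
  set P := μ.real (⋃ i ∈ I, D i)
  have hpairs : ∑ i ∈ I, ∑ j ∈ I, μ.real (D i ∩ D j) ≤ v + v ^ 2 := by
    refine (Finset.sum_le_sum fun i _ => Finset.sum_le_sum fun j _ => hpair i j).trans_eq ?_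
    simp only [Finset.sum_add_distrib, Finset.sum_ite_eq, Finset.sum_ite_mem, Finset.inter_self,
      hv_def, sq, Finset.sum_mul_sum]
  have hchain : (q * v) ^ 2 ≤ P * (v + v ^ 2) :=
    calc (q * v) ^ 2 ≤ (∑ i ∈ I, μ.real (D i)) ^ 2 := by
          gcongr
          rw [hv_def, Finset.mul_sum]
          exact Finset.sum_le_sum hqD
      _ ≤ P * ∑ i ∈ I, ∑ j ∈ I, μ.real (D i ∩ D j) :=
          sq_sum_measureReal_le_measureReal_biUnion_mul I hD
      _ ≤ P * (v + v ^ 2) := by gcongr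
  rcases (by positivity : 0 ≤ v).eq_or_lt with hv | hv
  · rw [← hv, mul_zero]
    positivity
  · refine le_of_mul_le_mul_right ?_ hv
    linarith

end SecondMoment

section LowerBound

variable {Ω : Type*} [MeasurableSpace Ω] {μ : Measure Ω}

theorem measureReal_inter_preimage_eq_mul_of_indepFun {β γ : Type*} [MeasurableSpace β]
    [MeasurableSpace γ] {f : Ω → β} {g : Ω → γ} (hfg : IndepFun f g μ) {s : Set β} {t : Set γ}
    (hs : MeasurableSet s) (ht : MeasurableSet t) :
    μ.real (f ⁻¹' s ∩ g ⁻¹' t) = μ.real (f ⁻¹' s) * μ.real (g ⁻¹' t) := by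
  simp only [measureReal_def, hfg.measure_inter_preimage_eq_mul s t hs ht, ENNReal.toReal_mul]

theorem sq_mul_sum_measureReal_norm_le {B ι : Type*} [NormedAddCommGroup B] [MeasurableSpace B]
    [BorelSpace B] [SecondCountableTopology B] [DecidableEq ι] [IsFiniteMeasure μ]
    {Y : ι → Ω → B} (hY : ∀ i, AEMeasurable (Y i) μ) (hind : iIndepFun Y μ) (I : Finset ι)
    {r q : ℝ} (hq : 0 ≤ q) (hqI : ∀ i ∈ I, q ≤ μ.real {ω | ‖∑ j ∈ I.erase i, Y j ω‖ ≤ r}) :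
    q ^ 2 * ∑ i ∈ I, μ.real {ω | 2 * r < ‖Y i ω‖} ≤
      (1 + ∑ i ∈ I, μ.real {ω | 2 * r < ‖Y i ω‖}) * μ.real {ω | r < ‖∑ i ∈ I, Y i ω‖} := by
  let far : Set B := {x | 2 * r < ‖x‖}
  have hfar : MeasurableSet far := measurableSet_lt measurable_const measurable_norm
  let near : Set B := {x | ‖x‖ ≤ r}
  have hnear : MeasurableSet near := measurableSet_le measurable_norm measurable_const
  let A : ι → Set Ω := fun i => Y i ⁻¹' far
  let D : ι → Set Ω := fun i => A i ∩ (∑ j ∈ I.erase i, Y j) ⁻¹' near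
  have hD (i) : NullMeasurableSet (D i) μ :=
    ((hY i).nullMeasurable hfar).inter
      ((Finset.aemeasurable_sum _ fun j _ => hY j).nullMeasurable hnear)
  have hqD (i) (hi : i ∈ I) : q * μ.real (A i) ≤ μ.real (D i) := by
    have hindep := hind.indepFun_finsetSum_of_notMem₀ hY (Finset.notMem_erase i I)
    rw [measureReal_inter_preimage_eq_mul_of_indepFun hindep.symm hfar hnear, mul_comm]
    refine mul_le_mul_of_nonneg_left ?_ measureReal_nonneg
    simpa [near] using hqI i hi
  have hD_subset : ⋃ i ∈ I, D i ⊆ {ω | r < ‖∑ i ∈ I, Y i ω‖} := by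
    refine Set.iUnion₂_subset fun i hi ω ⟨hω_far, hω_near⟩ => ?_
    have hω_far : 2 * r < ‖Y i ω‖ := hω_far
    have hω_near : ‖∑ j ∈ I.erase i, Y j ω‖ ≤ r := by simpa [near] using hω_near
    rw [Set.mem_ofPred_eq, ← Finset.add_sum_erase _ _ hi]
    linarith [norm_sub_le_norm_add (Y i ω) (∑ j ∈ I.erase i, Y j ω)]
  calc _ ≤ (1 + ∑ i ∈ I, μ.real (A i)) * μ.real (⋃ i ∈ I, D i) :=
        sq_mul_sum_measureReal_le_measureReal_biUnion I hq
          (fun i j hij =>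
            measureReal_inter_preimage_eq_mul_of_indepFun (hind.indepFun hij) hfar hfar)
          hD (fun i => Set.inter_subset_left) hqD
    _ ≤ _ := by
      refine mul_le_mul_of_nonneg_left (measureReal_mono hD_subset) ?_
      positivity

end LowerBound

section LipschitzFunctions

variable {B : Type*} [NormedAddCommGroup B]

theorem mem_Icc_of_lipschitzWith_one {F : B → ℝ} (hF : LipschitzWith 1 F) {x : B} {b : ℝ}
    (hx : ‖x‖ ≤ b) : F x ∈ Set.Icc (F 0 - b) (F 0 + b) := by
  have := hF.dist_le_mul x 0
  rw [Real.dist_eq, dist_zero_right, NNReal.coe_one, one_mul, abs_le] at this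
  constructor <;> linarith

theorem lipschitzWith_one_comp_add_left {F : B → ℝ} (hF : LipschitzWith 1 F) (x : B) :
    LipschitzWith 1 fun z => F (x + z) := by
  simpa only [mul_one, Function.comp_def] using hF.comp (isometry_add_left x).lipschitz

theorem ae_norm_sum_le {Ω ι : Type*} [MeasurableSpace Ω] {μ : Measure Ω} {Z : ι → Ω → B} {b : ℝ}
    (hb : ∀ i, ∀ᵐ ω ∂μ, ‖Z i ω‖ ≤ b) (I : Finset ι) :
    ∀ᵐ ω ∂μ, ‖∑ i ∈ I, Z i ω‖ ≤ I.card * b := by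
  have : ∀ᵐ ω ∂μ, ∀ i ∈ I, ‖Z i ω‖ ≤ b := (Finset.eventually_all I).2 fun i _ => hb i
  filter_upwards [this] with ω hω
  simpa using norm_sum_le_of_le I hω

theorem ae_norm_add_le {Ω : Type*} [MeasurableSpace Ω] {μ : Measure Ω} {S Z : Ω → B} {a b : ℝ}
    (ha : ∀ᵐ ω ∂μ, ‖S ω‖ ≤ a) (hb : ∀ᵐ ω ∂μ, ‖Z ω‖ ≤ b) : ∀ᵐ ω ∂μ, ‖S ω + Z ω‖ ≤ a + b := by
  filter_upwards [ha, hb] with ω hωa hωb using norm_add_le_of_le hωa hωb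

end LipschitzFunctions

section ExponentialMoments

variable {Ω B : Type*} [MeasurableSpace Ω] {μ : Measure Ω} [IsProbabilityMeasure μ]
  [NormedAddCommGroup B] [MeasurableSpace B] [BorelSpace B]

theorem integral_exp_le_exp_integral_add_integral_sq {U : Ω → ℝ} (hU : AEMeasurable U μ)
    (hU1 : ∀ᵐ ω ∂μ, |U ω| ≤ 1) :
    ∫ ω, Real.exp (U ω) ∂μ ≤ Real.exp (∫ ω, U ω ∂μ + ∫ ω, U ω ^ 2 ∂μ) := by
  have hU_int : Integrable U μ := .of_bound hU.aestronglyMeasurable 1 hU1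
  have hU2_int : Integrable (fun ω => U ω ^ 2) μ := by
    refine .of_bound (hU.pow_const 2).aestronglyMeasurable 1 ?_
    filter_upwards [hU1] with ω hω
    simpa using hω
  have hsum_int : Integrable (fun ω => U ω + U ω ^ 2) μ := hU_int.add hU2_int
  calc ∫ ω, Real.exp (U ω) ∂μ ≤ ∫ ω, (U ω + U ω ^ 2 + 1) ∂μ := by
        refine integral_mono_of_nonneg (ae_of_all _ fun ω => (Real.exp_pos _).le)
          (hsum_int.add (integrable_const 1)) ?_
        filter_upwards [hU1] with ω hω
        linarith [(abs_le.1 (Real.abs_exp_sub_one_sub_id_le hω)).2]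
    _ = (∫ ω, U ω ∂μ + ∫ ω, U ω ^ 2 ∂μ) + 1 := by
        rw [integral_add hsum_int (integrable_const 1), integral_add hU_int hU2_int]
        simp
    _ ≤ _ := Real.add_one_le_exp _

variable {Z : Ω → B}

theorem integrable_lipschitzWith_one_comp (hZ : AEMeasurable Z μ) {b : ℝ}
    (hb : ∀ᵐ ω ∂μ, ‖Z ω‖ ≤ b) {F : B → ℝ} (hF : LipschitzWith 1 F) :
    Integrable (fun ω => F (Z ω)) μ :=
  .of_mem_Icc _ _ (hF.continuous.measurable.comp_aemeasurable hZ)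
    (hb.mono fun _ hω => mem_Icc_of_lipschitzWith_one hF hω)

theorem integrable_exp_mul_lipschitzWith_one_comp (hZ : AEMeasurable Z μ) {b : ℝ}
    (hb : ∀ᵐ ω ∂μ, ‖Z ω‖ ≤ b) {F : B → ℝ} (hF : LipschitzWith 1 F) (l : ℝ) :
    Integrable (fun ω => Real.exp (l * F (Z ω))) μ :=
  integrable_exp_mul_of_mem_Icc (hF.continuous.measurable.comp_aemeasurable hZ)
    (hb.mono fun _ hω => mem_Icc_of_lipschitzWith_one hF hω)

theorem integral_exp_mul_lipschitzWith_one_comp_le (hZ : AEMeasurable Z μ) {b l : ℝ}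
    (hb : ∀ᵐ ω ∂μ, ‖Z ω‖ ≤ b) (hl : |l| * b ≤ 1) {F : B → ℝ} (hF : LipschitzWith 1 F) :
    ∫ ω, Real.exp (l * F (Z ω)) ∂μ ≤
      Real.exp (l ^ 2 * ∫ ω, ‖Z ω‖ ^ 2 ∂μ + l * ∫ ω, F (Z ω) ∂μ) := by
  have hFZ : AEMeasurable (fun ω => F (Z ω)) μ := hF.continuous.measurable.comp_aemeasurable hZ
  have hFZ_int := integrable_lipschitzWith_one_comp hZ hb hF
  have hdist (ω) : |F (Z ω) - F 0| ≤ ‖Z ω‖ := by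
    have := mem_Icc_of_lipschitzWith_one hF (le_refl ‖Z ω‖)
    rw [abs_le]
    constructor <;> linarith [this.1, this.2]
  set U : Ω → ℝ := fun ω => l * (F (Z ω) - F 0) with hU_def
  have hU1 : ∀ᵐ ω ∂μ, |U ω| ≤ 1 := by
    filter_upwards [hb] with ω hω
    rw [abs_mul]
    exact (mul_le_mul_of_nonneg_left ((hdist ω).trans hω) (abs_nonneg l)).trans hl
  have hU_mean : ∫ ω, U ω ∂μ = l * ∫ ω, F (Z ω) ∂μ - l * F 0 := by
    rw [hU_def, integral_const_mul, integral_sub hFZ_int (integrable_const _)]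
    simp [mul_sub]
  have hU_sq : ∫ ω, U ω ^ 2 ∂μ ≤ l ^ 2 * ∫ ω, ‖Z ω‖ ^ 2 ∂μ := by
    rw [← integral_const_mul]
    refine integral_mono_of_nonneg (ae_of_all _ fun ω => sq_nonneg _) ?_ (ae_of_all _ fun ω => ?_)
    · refine Integrable.const_mul
        (.of_bound (hZ.norm.pow_const 2).aestronglyMeasurable (b ^ 2) ?_) _
      filter_upwards [hb] with ω hω
      rw [norm_pow, norm_norm]
      gcongr
    · simp only [hU_def, mul_pow, ← sq_abs (F (Z ω) - F 0)]
      have := hdist ω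
      gcongr
  calc ∫ ω, Real.exp (l * F (Z ω)) ∂μ = Real.exp (l * F 0) * ∫ ω, Real.exp (U ω) ∂μ := by
        rw [← integral_const_mul]
        congr with ω
        rw [← Real.exp_add]
        congr 1
        ring
    _ ≤ Real.exp (l * F 0) * Real.exp (∫ ω, U ω ∂μ + ∫ ω, U ω ^ 2 ∂μ) := by
        gcongr
        exact integral_exp_le_exp_integral_add_integral_sq ((hFZ.sub_const _).const_mul l) hU1
    _ ≤ _ := by
        rw [← Real.exp_add]
        exact Real.exp_le_exp.2 (by linarith)

theorem lipschitzWith_one_integral_comp_add (hZ : AEMeasurable Z μ) {b : ℝ}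
    (hb : ∀ᵐ ω ∂μ, ‖Z ω‖ ≤ b) {F : B → ℝ} (hF : LipschitzWith 1 F) :
    LipschitzWith 1 fun x => ∫ ω, F (x + Z ω) ∂μ := by
  have hint (x : B) : Integrable (fun ω => F (x + Z ω)) μ :=
    integrable_lipschitzWith_one_comp hZ hb (lipschitzWith_one_comp_add_left hF x)
  refine LipschitzWith.of_dist_le_mul fun x y => ?_
  rw [dist_eq_norm, ← integral_sub (hint x) (hint y)]
  refine (norm_integral_le_of_norm_le_const (C := dist x y) (ae_of_all _ fun ω => ?_)).trans ?_
  · simpa [dist_eq_norm] using hF.dist_le_mul (x + Z ω) (y + Z ω)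
  · simp

theorem integral_comp_add_eq_of_indepFun [SecondCountableTopology B] {S : Ω → B}
    (hS : AEMeasurable S μ) (hZ : AEMeasurable Z μ)
    (hSZ : IndepFun S Z μ) {g : B → ℝ} (hg : Continuous g)
    (hint : Integrable (fun ω => g (S ω + Z ω)) μ) :
    ∫ ω, g (S ω + Z ω) ∂μ = ∫ ω, ∫ ω', g (S ω + Z ω') ∂μ ∂μ := by
  have hlaw := hSZ.map_add_eq_map_conv_map₀ hS hZ
  have hg_int : Integrable g (μ.map S ∗ μ.map Z) := by
    rwa [← hlaw, integrable_map_measure hg.aestronglyMeasurable (hS.add hZ)]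
  calc ∫ ω, g (S ω + Z ω) ∂μ = ∫ x, g x ∂(μ.map S ∗ μ.map Z) := by
        rw [← hlaw, integral_map (hS.add hZ) hg.aestronglyMeasurable]
        rfl
    _ = ∫ x, ∫ z, g (x + z) ∂(μ.map Z) ∂(μ.map S) := integral_conv hg_int
    _ = ∫ ω, ∫ z, g (S ω + z) ∂(μ.map Z) ∂μ := by
        refine integral_map hS (StronglyMeasurable.integral_prod_right ?_).aestronglyMeasurable
        exact Continuous.stronglyMeasurable (by fun_prop)
    _ = ∫ ω, ∫ ω', g (S ω + Z ω') ∂μ ∂μ := by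
        congr with ω
        exact integral_map hZ (by fun_prop)

theorem integral_exp_mul_lipschitzWith_one_add_le [SecondCountableTopology B] {S : Ω → B}
    (hS : AEMeasurable S μ) (hZ : AEMeasurable Z μ) (hSZ : IndepFun S Z μ) {a b l : ℝ}
    (ha : ∀ᵐ ω ∂μ, ‖S ω‖ ≤ a) (hb : ∀ᵐ ω ∂μ, ‖Z ω‖ ≤ b) (hl : |l| * b ≤ 1) {F : B → ℝ}
    (hF : LipschitzWith 1 F) :
    ∫ ω, Real.exp (l * F (S ω + Z ω)) ∂μ ≤ Real.exp (l ^ 2 * ∫ ω, ‖Z ω‖ ^ 2 ∂μ) *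
      ∫ ω, Real.exp (l * ∫ ω', F (S ω + Z ω') ∂μ) ∂μ := by
  have hexp_int : Integrable (fun ω => Real.exp (l * F (S ω + Z ω))) μ :=
    integrable_exp_mul_lipschitzWith_one_comp (hS.add hZ) (ae_norm_add_le ha hb) hF l
  have hcont : Continuous fun x => Real.exp (l * F x) :=
    Real.continuous_exp.comp (hF.continuous.const_mul l)
  rw [integral_comp_add_eq_of_indepFun hS hZ hSZ hcont hexp_int, ← integral_const_mul]
  refine integral_mono_of_nonneg
    (ae_of_all _ fun ω => integral_nonneg fun _ => (Real.exp_pos _).le)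
    ((integrable_exp_mul_lipschitzWith_one_comp hS ha
      (lipschitzWith_one_integral_comp_add hZ hb hF) l).const_mul _)
    (ae_of_all _ fun ω => ?_)
  simpa only [Real.exp_add] using integral_exp_mul_lipschitzWith_one_comp_le hZ hb hl
    (lipschitzWith_one_comp_add_left hF (S ω))

end ExponentialMoments

section ConcentrationOfSums

variable {Ω B ι : Type*} [MeasurableSpace Ω] {μ : Measure Ω} [IsProbabilityMeasure μ]
  [NormedAddCommGroup B] [MeasurableSpace B] [BorelSpace B] [SecondCountableTopology B]
  {Z : ι → Ω → B} {b : ℝ}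

theorem integral_exp_mul_lipschitzWith_one_sum_le (hZ : ∀ i, AEMeasurable (Z i) μ)
    (hind : iIndepFun Z μ) (hb : ∀ i, ∀ᵐ ω ∂μ, ‖Z i ω‖ ≤ b) {l : ℝ} (hl : |l| * b ≤ 1)
    (I : Finset ι) {F : B → ℝ} (hF : LipschitzWith 1 F) :
    ∫ ω, Real.exp (l * F (∑ i ∈ I, Z i ω)) ∂μ ≤
      Real.exp (l ^ 2 * ∑ i ∈ I, ∫ ω, ‖Z i ω‖ ^ 2 ∂μ + l * ∫ ω, F (∑ i ∈ I, Z i ω) ∂μ) := by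
  classical
  induction I using Finset.induction_on generalizing F with
  | empty => simp
  | insert i I hi ih =>
    have hindep : IndepFun (fun ω => ∑ j ∈ I, Z j ω) (Z i) μ := by
      simpa only [Finset.sum_fn] using hind.indepFun_finsetSum_of_notMem₀ hZ hi
    have hS : AEMeasurable (fun ω => ∑ j ∈ I, Z j ω) μ :=
      Finset.aemeasurable_fun_sum I fun j _ => hZ j
    have hS_bdd := ae_norm_sum_le hb I
    have hsum_int : Integrable (fun ω => F (∑ j ∈ I, Z j ω + Z i ω)) μ :=
      integrable_lipschitzWith_one_comp (hS.add (hZ i)) (ae_norm_add_le hS_bdd (hb i)) hF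
    have hG := ih (lipschitzWith_one_integral_comp_add (hZ i) (hb i) hF)
    simp only [Finset.sum_insert hi, add_comm (Z i _)]
    refine (integral_exp_mul_lipschitzWith_one_add_le hS (hZ i) hindep hS_bdd (hb i) hl hF).trans
      ((mul_le_mul_of_nonneg_left hG (Real.exp_pos _).le).trans_eq ?_)
    rw [← Real.exp_add, integral_comp_add_eq_of_indepFun hS (hZ i) hindep hF.continuous hsum_int]
    congr 1
    ring

theorem measureReal_ge_integral_add_le (hZ : ∀ i, AEMeasurable (Z i) μ)
    (hind : iIndepFun Z μ) (hb : ∀ i, ∀ᵐ ω ∂μ, ‖Z i ω‖ ≤ b) {l : ℝ} (hl : 0 ≤ l) (hlb : l * b ≤ 1)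
    (I : Finset ι) {F : B → ℝ} (hF : LipschitzWith 1 F) (r : ℝ) :
    μ.real {ω | ∫ ω', F (∑ i ∈ I, Z i ω') ∂μ + r ≤ F (∑ i ∈ I, Z i ω)} ≤
      Real.exp (l ^ 2 * ∑ i ∈ I, ∫ ω, ‖Z i ω‖ ^ 2 ∂μ - l * r) := by
  set m := ∫ ω', F (∑ i ∈ I, Z i ω') ∂μ
  have hmgf := integral_exp_mul_lipschitzWith_one_sum_le hZ hind hb (by rwa [abs_of_nonneg hl]) I hF
  calc _ ≤ Real.exp (-l * (m + r)) * mgf (fun ω => F (∑ i ∈ I, Z i ω)) μ l :=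
        measure_ge_le_exp_mul_mgf _ hl <| integrable_exp_mul_lipschitzWith_one_comp
          (Finset.aemeasurable_fun_sum I fun i _ => hZ i) (ae_norm_sum_le hb I) hF l
    _ ≤ Real.exp (-l * (m + r)) *
        Real.exp (l ^ 2 * ∑ i ∈ I, ∫ ω, ‖Z i ω‖ ^ 2 ∂μ + l * m) := by
        gcongr
        exact hmgf
    _ = _ := by
        rw [← Real.exp_add]
        congr 1
        ring

theorem measureReal_ge_add_two_mul_le (hZ : ∀ i, AEMeasurable (Z i) μ)
    (hind : iIndepFun Z μ) (hb : ∀ i, ∀ᵐ ω ∂μ, ‖Z i ω‖ ≤ b) {l : ℝ} (hl : 0 ≤ l) (hlb : l * b ≤ 1)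
    (I : Finset ι) {F : B → ℝ} (hF : LipschitzWith 1 F) {a r : ℝ}
    (ha : Real.exp (l ^ 2 * ∑ i ∈ I, ∫ ω, ‖Z i ω‖ ^ 2 ∂μ - l * r) <
      μ.real {ω | F (∑ i ∈ I, Z i ω) ≤ a}) :
    μ.real {ω | a + 2 * r ≤ F (∑ i ∈ I, Z i ω)} ≤
      Real.exp (l ^ 2 * ∑ i ∈ I, ∫ ω, ‖Z i ω‖ ^ 2 ∂μ - l * r) := by
  have hmean : ∫ ω, F (∑ i ∈ I, Z i ω) ∂μ < a + r := by
    by_contra! hcon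
    have hlower := measureReal_ge_integral_add_le hZ hind hb hl hlb I hF.neg r
    refine (hlower.trans_lt ha).not_ge (measureReal_mono fun ω hω => ?_)
    have hω : F (∑ i ∈ I, Z i ω) ≤ a := hω
    simp only [Set.mem_ofPred_eq, integral_neg, Pi.neg_apply]
    linarith
  refine (measureReal_mono fun ω hω => ?_).trans
    (measureReal_ge_integral_add_le hZ hind hb hl hlb I hF r)
  have hω : a + 2 * r ≤ F (∑ i ∈ I, Z i ω) := hω
  simp only [Set.mem_ofPred_eq]
  linarith

end ConcentrationOfSums

section Truncation

variable {B : Type*} [NormedAddCommGroup B]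

/-- The truncation of a vector at level `b`: it is kept if its norm is at most `b`, and replaced by
zero otherwise. -/
noncomputable def truncNorm (b : ℝ) : B → B :=
  (Metric.closedBall (0 : B) b).indicator id

theorem truncNorm_of_le {b : ℝ} {x : B} (h : ‖x‖ ≤ b) : truncNorm b x = x :=
  Set.indicator_of_mem (mem_closedBall_zero_iff.2 h) id

theorem norm_truncNorm_le_norm (b : ℝ) (x : B) : ‖truncNorm b x‖ ≤ ‖x‖ :=
  norm_indicator_le_norm_self _ _

theorem norm_truncNorm_le {b : ℝ} (hb : 0 ≤ b) (x : B) : ‖truncNorm b x‖ ≤ b := by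
  classical
  rw [truncNorm, Set.indicator_apply]
  split_ifs with h
  · exact mem_closedBall_zero_iff.1 h
  · rwa [norm_zero]

theorem eqOn_sum_truncNorm {Ω ι : Type*} (Y : ι → Ω → B) (b : ℝ) (I : Finset ι) :
    Set.EqOn (fun ω => ∑ i ∈ I, Y i ω) (fun ω => ∑ i ∈ I, truncNorm b (Y i ω))
      (⋃ i ∈ I, {ω | b < ‖Y i ω‖})ᶜ := by
  intro ω hω
  simp only [Set.mem_compl_iff, Set.mem_iUnion, Set.mem_ofPred_eq, not_exists, not_lt] at hω
  exact Finset.sum_congr rfl fun i hi => (truncNorm_of_le (hω i hi)).symm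

theorem measurable_truncNorm [MeasurableSpace B] [BorelSpace B] (b : ℝ) :
    Measurable (truncNorm b : B → B) :=
  measurable_id.indicator Metric.isClosed_closedBall.measurableSet

end Truncation

section MomentFromTail

variable {Ω : Type*} [MeasurableSpace Ω] {μ : Measure Ω}

theorem integral_le_of_measureReal_lt_le_rpow_neg {f : Ω → ℝ} {m C a : ℝ} (hf : Integrable f μ)
    (hf0 : ∀ ω, 0 ≤ f ω) (hm : 0 ≤ m) (hfm : ∀ ω, f ω ≤ m) (ha : a < 1)
    (htail : ∀ t, 0 < t → μ.real {ω | t < f ω} ≤ C * t ^ (-a)) :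
    ∫ ω, f ω ∂μ ≤ C * (m ^ (1 - a) / (1 - a)) := by
  have hint : IntervalIntegrable (fun t : ℝ => C * t ^ (-a)) volume 0 m :=
    (intervalIntegral.intervalIntegrable_rpow' (by linarith)).const_mul C
  calc ∫ ω, f ω ∂μ = ∫ t in Set.Ioc 0 m, μ.real {ω | t ≤ f ω} :=
        hf.integral_eq_integral_Ioc_meas_le (ae_of_all _ hf0) (ae_of_all _ hfm)
    _ ≤ ∫ t in Set.Ioc 0 m, C * t ^ (-a) := by
        refine integral_mono_of_nonneg (ae_of_all _ fun _ => measureReal_nonneg)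
          ((intervalIntegrable_iff_integrableOn_Ioc_of_le hm).1 hint) ?_
        filter_upwards [meas_le_ae_eq_meas_lt μ (volume.restrict (Set.Ioc 0 m)) f,
          ae_restrict_mem measurableSet_Ioc] with t ht ht0
        rw [measureReal_def, ht]
        exact htail t ht0.1
    _ = C * (m ^ (1 - a) / (1 - a)) := by
        rw [← intervalIntegral.integral_of_le hm, intervalIntegral.integral_const_mul,
          integral_rpow (Or.inl (by linarith)), neg_add_eq_sub, Real.zero_rpow (by linarith),
          sub_zero]

theorem integral_rpow_le_of_measureReal_lt_le_rpow_neg [IsFiniteMeasure μ] {f : Ω → ℝ}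
    {b C p q : ℝ} (hf : AEMeasurable f μ) (hf0 : ∀ ω, 0 ≤ f ω) (hb : 0 ≤ b) (hfb : ∀ ω, f ω ≤ b)
    (hq : 0 < q) (hpq : p < q) (htail : ∀ t, 0 < t → μ.real {ω | t < f ω} ≤ C * t ^ (-p)) :
    ∫ ω, f ω ^ q ∂μ ≤ C * q / (q - p) * b ^ (q - p) := by
  have hfq0 (ω) : 0 ≤ f ω ^ q := Real.rpow_nonneg (hf0 ω) q
  have hfqb (ω) : f ω ^ q ≤ b ^ q := Real.rpow_le_rpow (hf0 ω) (hfb ω) hq.le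
  have hint : Integrable (fun ω => f ω ^ q) μ :=
    .of_mem_Icc 0 (b ^ q) (hf.pow_const q) (ae_of_all _ fun ω => ⟨hfq0 ω, hfqb ω⟩)
  have hfq_tail (t : ℝ) (ht : 0 < t) : μ.real {ω | t < f ω ^ q} ≤ C * t ^ (-(p / q)) := by
    convert htail (t ^ q⁻¹) (by positivity) using 1
    · congr! 3 with ω
      exact (Real.rpow_inv_lt_iff_of_pos ht.le (hf0 ω) hq).symm
    · rw [← Real.rpow_mul ht.le]
      congr 2
      ring
  have hqp : 0 < q - p := sub_pos.2 hpq
  convert integral_le_of_measureReal_lt_le_rpow_neg hint hfq0 (Real.rpow_nonneg hb q) hfqb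
    ((div_lt_one hq).2 hpq) hfq_tail using 1
  rw [← Real.rpow_mul hb, mul_sub, mul_one, mul_div_cancel₀ p hq.ne']
  field_simp

end MomentFromTail

section UpperBound

theorem measureReal_preimage_le_add_of_eqOn_compl {Ω B : Type*} [MeasurableSpace Ω] {μ : Measure Ω}
    [IsFiniteMeasure μ] {f g : Ω → B} {U : Set Ω} (hfg : Set.EqOn f g Uᶜ) (E : Set B) :
    μ.real (f ⁻¹' E) ≤ μ.real U + μ.real (g ⁻¹' E) := by
  refine (measureReal_mono fun ω hω => ?_).trans (measureReal_union_le _ _)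
  by_cases hωU : ω ∈ U
  · exact .inl hωU
  · exact .inr (by rwa [Set.mem_preimage, ← hfg hωU])

variable {Ω B ι : Type*} [MeasurableSpace Ω] {μ : Measure Ω} [NormedAddCommGroup B]
  [MeasurableSpace B] [BorelSpace B]

theorem integral_norm_truncNorm_sq_le [IsFiniteMeasure μ] {X : Ω → B} (hX : AEMeasurable X μ)
    {b C p : ℝ} (hb : 0 ≤ b) (hp2 : p < 2)
    (htail : ∀ t, 0 < t → μ.real {ω | t < ‖X ω‖} ≤ C * t ^ (-p)) :
    ∫ ω, ‖truncNorm b (X ω)‖ ^ 2 ∂μ ≤ C * 2 / (2 - p) * b ^ (2 - p) := by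
  simp only [← Real.rpow_two]
  refine integral_rpow_le_of_measureReal_lt_le_rpow_neg
    ((measurable_truncNorm b).comp_aemeasurable hX).norm (fun ω => norm_nonneg _) hb
    (fun ω => norm_truncNorm_le hb _) two_pos hp2 fun t ht =>
      (measureReal_mono fun ω hω => ?_).trans (htail t ht)
  exact hω.trans_le (norm_truncNorm_le_norm b (X ω))

/-- The sum of the truncated terms concentrates around its mean, and the mean is at most `2 * r`
because the norm of that sum is at most `r` with sufficiently large probability. -/
theorem measureReal_norm_sum_le [SecondCountableTopology B] [IsProbabilityMeasure μ]
    {Y : ι → Ω → B} (hY : ∀ i, AEMeasurable (Y i) μ) (hind : iIndepFun Y μ) (I : Finset ι)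
    {b l r : ℝ} (hb : 0 ≤ b) (hl : 0 ≤ l) (hlb : l * b ≤ 1)
    (hsmall : ∑ i ∈ I, μ.real {ω | b < ‖Y i ω‖} + μ.real {ω | r < ‖∑ i ∈ I, Y i ω‖} +
      Real.exp (l ^ 2 * ∑ i ∈ I, ∫ ω, ‖truncNorm b (Y i ω)‖ ^ 2 ∂μ - l * r) < 1) :
    μ.real {ω | 3 * r < ‖∑ i ∈ I, Y i ω‖} ≤ ∑ i ∈ I, μ.real {ω | b < ‖Y i ω‖} +
      Real.exp (l ^ 2 * ∑ i ∈ I, ∫ ω, ‖truncNorm b (Y i ω)‖ ^ 2 ∂μ - l * r) := by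
  set Z : ι → Ω → B := fun i ω => truncNorm b (Y i ω)
  have hZ (i) : AEMeasurable (Z i) μ := (measurable_truncNorm b).comp_aemeasurable (hY i)
  have hZind : iIndepFun Z μ := hind.comp (fun _ => truncNorm b) fun _ => measurable_truncNorm b
  have hU : μ.real (⋃ i ∈ I, {ω | b < ‖Y i ω‖}) ≤ ∑ i ∈ I, μ.real {ω | b < ‖Y i ω‖} :=
    measureReal_biUnion_finset_le _ _
  have hYZ := eqOn_sum_truncNorm Y b I
  have hZ_small : 1 - (∑ i ∈ I, μ.real {ω | b < ‖Y i ω‖} + μ.real {ω | r < ‖∑ i ∈ I, Y i ω‖}) ≤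
      μ.real {ω | ‖∑ i ∈ I, Z i ω‖ ≤ r} := by
    have hmeas : NullMeasurableSet {ω | ‖∑ i ∈ I, Z i ω‖ ≤ r} μ :=
      nullMeasurableSet_le (Finset.aemeasurable_fun_sum I fun i _ => hZ i).norm aemeasurable_const
    have hcompl : μ.real {ω | ‖∑ i ∈ I, Z i ω‖ ≤ r}ᶜ ≤
        μ.real (⋃ i ∈ I, {ω | b < ‖Y i ω‖}) + μ.real {ω | r < ‖∑ i ∈ I, Y i ω‖} := by
      simpa only [Set.compl_ofPred, not_le, Set.preimage_ofPred_eq] using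
        measureReal_preimage_le_add_of_eqOn_compl hYZ.symm {x | r < ‖x‖}
    rw [probReal_compl_eq_one_sub₀ hmeas] at hcompl
    linarith
  have hZ_large := measureReal_ge_add_two_mul_le hZ hZind
    (fun i => ae_of_all μ fun ω => norm_truncNorm_le hb (Y i ω)) hl hlb I lipschitzWith_one_norm
    (a := r) (r := r) (by linarith)
  have hY_le := measureReal_preimage_le_add_of_eqOn_compl (μ := μ) hYZ {x | 3 * r < ‖x‖}
  have hmono : μ.real {ω | 3 * r < ‖∑ i ∈ I, Z i ω‖} ≤
      μ.real {ω | r + 2 * r ≤ ‖∑ i ∈ I, Z i ω‖} := by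
    refine measureReal_mono fun ω (hω : 3 * r < _) => ?_
    simp only [Set.mem_ofPred_eq]
    linarith
  exact hY_le.trans (add_le_add hU (hmono.trans hZ_large))

end UpperBound

section NormTail

variable {Ω B : Type*} [MeasurableSpace Ω] {μ : Measure Ω} [NormedAddCommGroup B] {X : Ω → B}

/-- The tail function `t ↦ ℙ(‖X‖ > t)` of a random vector `X`. -/
noncomputable def normTail (μ : Measure Ω) (X : Ω → B) (t : ℝ) : ℝ :=
  μ.real {ω | t < ‖X ω‖}

theorem normTail_nonneg (t : ℝ) : 0 ≤ normTail μ X t :=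
  measureReal_nonneg

theorem normTail_le_one [IsProbabilityMeasure μ] (t : ℝ) : normTail μ X t ≤ 1 :=
  measureReal_le_one

theorem antitone_normTail [IsFiniteMeasure μ] : Antitone (normTail μ X) :=
  fun _ _ hst => measureReal_mono fun _ hω => hst.trans_lt hω

theorem tendsto_normTail_atTop [IsFiniteMeasure μ] [MeasurableSpace B] [OpensMeasurableSpace B]
    (hX : AEMeasurable X μ) : Tendsto (normTail μ X) atTop (𝓝 0) := by
  have hempty : ⋂ t : ℝ, {ω | t < ‖X ω‖} = ∅ :=
    Set.eq_empty_of_forall_notMem fun ω hω => lt_irrefl ‖X ω‖ (Set.mem_iInter.1 hω ‖X ω‖)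
  have := tendsto_measure_iInter_atTop (μ := μ) (s := fun t : ℝ => {ω | t < ‖X ω‖})
    (fun t => nullMeasurableSet_lt aemeasurable_const hX.norm)
    (fun s t hst ω hω => hst.trans_lt hω) ⟨0, measure_ne_top _ _⟩
  rw [hempty, measure_empty] at this
  exact (ENNReal.tendsto_toReal ENNReal.zero_ne_top).comp this

theorem normTail_eq_of_identDistrib [MeasurableSpace B] [OpensMeasurableSpace B] {Y : Ω → B}
    (h : IdentDistrib Y X μ μ) (t : ℝ) : normTail μ Y t = normTail μ X t :=
  congrArg ENNReal.toReal (h.norm.measure_mem_eq measurableSet_Ioi)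

end NormTail

section WeakLaw

variable {Ω B : Type*} [MeasurableSpace Ω] {μ : Measure Ω} [IsProbabilityMeasure μ]
  [NormedAddCommGroup B] [MeasurableSpace B] [BorelSpace B] [SecondCountableTopology B]

theorem one_sub_le_measureReal_norm_sum_erase_le {ι : Type*} [DecidableEq ι] {Y : ι → Ω → B}
    (hY : ∀ i, AEMeasurable (Y i) μ) {I : Finset ι} {i : ι} (hi : i ∈ I) (r : ℝ) :
    1 - (normTail μ (fun ω => ∑ j ∈ I, Y j ω) (r / 2) + normTail μ (Y i) (r / 2)) ≤
      μ.real {ω | ‖∑ j ∈ I.erase i, Y j ω‖ ≤ r} := by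
  have hmeas : NullMeasurableSet {ω | ‖∑ j ∈ I.erase i, Y j ω‖ ≤ r} μ :=
    nullMeasurableSet_le (Finset.aemeasurable_fun_sum _ fun j _ => hY j).norm aemeasurable_const
  have hcompl : μ.real {ω | ‖∑ j ∈ I.erase i, Y j ω‖ ≤ r}ᶜ ≤
      normTail μ (fun ω => ∑ j ∈ I, Y j ω) (r / 2) + normTail μ (Y i) (r / 2) := by
    refine (measureReal_mono fun ω hω => ?_).trans (measureReal_union_le _ _)
    simp only [Set.mem_compl_iff, Set.mem_ofPred_eq, not_le, Set.mem_union] at hω ⊢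
    by_contra! hcon
    have := norm_sub_le (∑ j ∈ I, Y j ω) (Y i ω)
    rw [← Finset.sum_erase_eq_sub hi] at this
    linarith
  rw [probReal_compl_eq_one_sub₀ hmeas] at hcompl
  linarith

theorem sum_normTail_le_one_and_le_mul_normTail_sum {ι : Type*} {Y : ι → Ω → B}
    (hY : ∀ i, AEMeasurable (Y i) μ) (hind : iIndepFun Y μ) {I : Finset ι} {r : ℝ}
    (hr : normTail μ (fun ω => ∑ i ∈ I, Y i ω) r ≤ 1 / 8)
    (hr_half : normTail μ (fun ω => ∑ i ∈ I, Y i ω) (r / 2) ≤ 1 / 4)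
    (hY_half : ∀ i ∈ I, normTail μ (Y i) (r / 2) ≤ 1 / 4) :
    ∑ i ∈ I, normTail μ (Y i) (2 * r) ≤ 1 ∧
      ∑ i ∈ I, normTail μ (Y i) (2 * r) ≤ 8 * normTail μ (fun ω => ∑ i ∈ I, Y i ω) r := by
  classical
  have hq (i) (hi : i ∈ I) : 1 / 2 ≤ μ.real {ω | ‖∑ j ∈ I.erase i, Y j ω‖ ≤ r} := by
    linarith [one_sub_le_measureReal_norm_sum_erase_le hY hi r, hY_half i hi]
  have hle : (1 / 2) ^ 2 * ∑ i ∈ I, normTail μ (Y i) (2 * r) ≤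
      (1 + ∑ i ∈ I, normTail μ (Y i) (2 * r)) * normTail μ (fun ω => ∑ i ∈ I, Y i ω) r :=
    sq_mul_sum_measureReal_norm_le hY hind I one_half_pos.le hq
  have hv : 0 ≤ ∑ i ∈ I, normTail μ (Y i) (2 * r) := Finset.sum_nonneg fun i _ => normTail_nonneg _
  have hP : 0 ≤ normTail μ (fun ω => ∑ i ∈ I, Y i ω) r := normTail_nonneg r
  have hv1 : ∑ i ∈ I, normTail μ (Y i) (2 * r) ≤ 1 := by nlinarith [hP]
  exact ⟨hv1, by nlinarith [hP]⟩

variable {X : Ω → B} {Y : ℕ → Ω → B} {p : ℝ}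

theorem eventually_mul_normTail_le (hind : iIndepFun Y μ) (hident : ∀ i, IdentDistrib (Y i) X μ μ)
    (hp : 0 < p)
    (hwlln : ∀ s, 0 < s →
      Tendsto (fun n : ℕ => normTail μ (partialSum Y n) (s * (n : ℝ) ^ (1 / p))) atTop (𝓝 0))
    {s : ℝ} (hs : 0 < s) :
    ∀ᶠ n : ℕ in atTop, n * normTail μ X (2 * (s * (n : ℝ) ^ (1 / p))) ≤ 1 ∧
      n * normTail μ X (2 * (s * (n : ℝ) ^ (1 / p))) ≤
        8 * normTail μ (partialSum Y n) (s * (n : ℝ) ^ (1 / p)) := by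
  have hs2 : 0 < s / 2 := half_pos hs
  have hlevel : Tendsto (fun n : ℕ => s / 2 * (n : ℝ) ^ (1 / p)) atTop atTop :=
    ((tendsto_rpow_atTop (one_div_pos.2 hp)).comp tendsto_natCast_atTop_atTop).const_mul_atTop hs2
  have hX := (tendsto_normTail_atTop (hident 0).aemeasurable_snd).comp hlevel
  filter_upwards [(hwlln s hs).eventually_le_const (by norm_num : (0 : ℝ) < 1 / 8),
    (hwlln (s / 2) hs2).eventually_le_const (by norm_num : (0 : ℝ) < 1 / 4),
    hX.eventually_le_const (by norm_num : (0 : ℝ) < 1 / 4)] with n hn hn_half hX_half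
  have hhalf : s * (n : ℝ) ^ (1 / p) / 2 = s / 2 * (n : ℝ) ^ (1 / p) := by ring
  have hsum : ∑ i ∈ Finset.range n, normTail μ (Y i) (2 * (s * (n : ℝ) ^ (1 / p))) =
      n * normTail μ X (2 * (s * (n : ℝ) ^ (1 / p))) := by
    simp [normTail_eq_of_identDistrib (hident _)]
  rw [← hsum]
  exact sum_normTail_le_one_and_le_mul_normTail_sum (I := Finset.range n)
    (fun i => (hident i).aemeasurable_fst) hind hn (by rwa [hhalf])
    (fun i _ => by rwa [hhalf, normTail_eq_of_identDistrib (hident i)])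

theorem exists_normTail_le_mul_rpow_neg (hind : iIndepFun Y μ)
    (hident : ∀ i, IdentDistrib (Y i) X μ μ) (hp : 0 < p)
    (hwlln : ∀ s, 0 < s →
      Tendsto (fun n : ℕ => normTail μ (partialSum Y n) (s * (n : ℝ) ^ (1 / p))) atTop (𝓝 0)) :
    ∃ C, ∀ t, 0 < t → normTail μ X t ≤ C * t ^ (-p) := by
  obtain ⟨m, hm⟩ := eventually_atTop.1
    (eventually_mul_normTail_le hind hident hp hwlln one_half_pos)
  refine ⟨m + 2, fun t ht => ?_⟩
  have htp : 0 < t ^ p := Real.rpow_pos_of_pos ht p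
  rw [Real.rpow_neg ht.le, ← div_eq_mul_inv, le_div_iff₀ htp]
  rcases le_or_gt (t ^ p) (m + 1) with hsmall | hlarge
  · nlinarith [normTail_le_one (μ := μ) (X := X) t]
  · have hfloor : m + 1 ≤ ⌊t ^ p⌋₊ := Nat.le_floor (by exact_mod_cast hlarge.le)
    have hlevel : 2 * (1 / 2 * (⌊t ^ p⌋₊ : ℝ) ^ (1 / p)) ≤ t := by
      rw [← mul_assoc, mul_one_div_cancel two_ne_zero, one_mul, one_div,
        Real.rpow_inv_le_iff_of_pos (Nat.cast_nonneg _) ht.le hp]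
      exact Nat.floor_le htp.le
    have hV := normTail_nonneg (μ := μ) (X := X) t
    have hmono := antitone_normTail (μ := μ) (X := X) hlevel
    have hle := (hm ⌊t ^ p⌋₊ (by lia)).1
    have hfloor_one : (1 : ℝ) ≤ ⌊t ^ p⌋₊ := by exact_mod_cast (by lia : 1 ≤ ⌊t ^ p⌋₊)
    calc normTail μ X t * t ^ p ≤ normTail μ X t * (2 * ⌊t ^ p⌋₊) := by
          gcongr
          linarith [Nat.lt_floor_add_one (t ^ p)]
      _ = 2 * (⌊t ^ p⌋₊ * normTail μ X t) := by ring
      _ ≤ 2 * 1 := by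
          gcongr
          exact (mul_le_mul_of_nonneg_left hmono (Nat.cast_nonneg _)).trans hle
      _ ≤ m + 2 := by
          rw [mul_one]
          exact le_add_of_nonneg_left (Nat.cast_nonneg m)

end WeakLaw

section ExponentialError

theorem eventually_exp_sub_mul_rpow_le_rpow {a δ : ℝ} (ha : 0 < a) (hδ : 0 < δ) (M K : ℝ) :
    ∀ᶠ x : ℝ in atTop, Real.exp (M - a * x ^ δ) ≤ x ^ K := by
  have hlittle := ((isLittleO_exp_neg_mul_rpow_atTop ha (K / δ)).comp_tendsto
    (tendsto_rpow_atTop hδ)).def (Real.exp_pos (-M))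
  filter_upwards [hlittle, eventually_gt_atTop 0] with x hx hx0
  simp only [Function.comp_apply, ← Real.rpow_mul hx0.le, mul_div_cancel₀ K hδ.ne',
    Real.norm_of_nonneg (Real.exp_pos _).le, Real.norm_of_nonneg (Real.rpow_nonneg hx0.le K)] at hx
  calc Real.exp (M - a * x ^ δ) = Real.exp M * Real.exp (-a * x ^ δ) := by
        rw [← Real.exp_add, neg_mul, sub_eq_add_neg]
    _ ≤ Real.exp M * (Real.exp (-M) * x ^ K) := by gcongr
    _ = x ^ K := by rw [← mul_assoc, ← Real.exp_add, add_neg_cancel, Real.exp_zero, one_mul]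

end ExponentialError

section UpperBoundUnderWeakLaw

variable {Ω B : Type*} [MeasurableSpace Ω] {μ : Measure Ω} [IsProbabilityMeasure μ]
  [NormedAddCommGroup B] [MeasurableSpace B] [BorelSpace B] {X : Ω → B} {Y : ℕ → Ω → B} {p : ℝ}

/-- The relation between `δ` and `ε` makes the powers of `n` cancel, so that truncation at level
`n ^ (1 / p - ε)` leaves room for the exponential rate `n ^ (δ - 1 / p)`. -/
theorem sq_rpow_mul_sum_integral_norm_truncNorm_sq_le (hident : ∀ i, IdentDistrib (Y i) X μ μ)
    (hp0 : 0 < p) (hp2 : p < 2) {C : ℝ}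
    (htail : ∀ t, 0 < t → normTail μ X t ≤ C * t ^ (-p)) {δ ε : ℝ} (hδε : 2 * δ = (2 - p) * ε)
    {n : ℕ} (hn : 0 < n) :
    ((n : ℝ) ^ (δ - 1 / p)) ^ 2 *
      ∑ i ∈ Finset.range n, ∫ ω, ‖truncNorm ((n : ℝ) ^ (1 / p - ε)) (Y i ω)‖ ^ 2 ∂μ ≤
      C * 2 / (2 - p) := by
  have hn0 : (0 : ℝ) < n := Nat.cast_pos.2 hn
  set b := (n : ℝ) ^ (1 / p - ε) with hb_def
  have hmoment (i) : ∫ ω, ‖truncNorm b (Y i ω)‖ ^ 2 ∂μ ≤ C * 2 / (2 - p) * b ^ (2 - p) :=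
    integral_norm_truncNorm_sq_le (hident i).aemeasurable_fst (by positivity) hp2 fun t ht =>
      (normTail_eq_of_identDistrib (hident i) t).trans_le (htail t ht)
  have hpow : ((n : ℝ) ^ (δ - 1 / p)) ^ 2 * b ^ (2 - p) = (n : ℝ)⁻¹ := by
    rw [hb_def, ← Real.rpow_mul_natCast hn0.le, ← Real.rpow_mul hn0.le, ← Real.rpow_add hn0,
      ← Real.rpow_neg_one]
    congr 1
    have := mul_one_div_cancel hp0.ne'
    push_cast
    linear_combination hδε - this
  calc _ ≤ ((n : ℝ) ^ (δ - 1 / p)) ^ 2 * (n * (C * 2 / (2 - p) * b ^ (2 - p))) := by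
        gcongr
        simpa using Finset.sum_le_card_nsmul (Finset.range n) _ _ fun i _ => hmoment i
    _ = C * 2 / (2 - p) * (n * (((n : ℝ) ^ (δ - 1 / p)) ^ 2 * b ^ (2 - p))) := by ring
    _ = C * 2 / (2 - p) := by rw [hpow, mul_inv_cancel₀ hn0.ne', mul_one]

variable [SecondCountableTopology B]

theorem normTail_partialSum_le_add_exp (hind : iIndepFun Y μ)
    (hident : ∀ i, IdentDistrib (Y i) X μ μ) (hp0 : 0 < p) (hp2 : p < 2) {C : ℝ}
    (htail : ∀ t, 0 < t → normTail μ X t ≤ C * t ^ (-p)) {δ ε s : ℝ} (hε : 0 < ε)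
    (hδε : 2 * δ = (2 - p) * ε) {n : ℕ} (hn : 0 < n)
    (hsmall : n * normTail μ X ((n : ℝ) ^ (1 / p - ε)) +
      normTail μ (partialSum Y n) (s * (n : ℝ) ^ (1 / p)) +
      Real.exp (C * 2 / (2 - p) - s * (n : ℝ) ^ δ) < 1) :
    normTail μ (partialSum Y n) (3 * (s * (n : ℝ) ^ (1 / p))) ≤
      n * normTail μ X ((n : ℝ) ^ (1 / p - ε)) +
      Real.exp (C * 2 / (2 - p) - s * (n : ℝ) ^ δ) := by
  have hn0 : (0 : ℝ) < n := Nat.cast_pos.2 hn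
  set b := (n : ℝ) ^ (1 / p - ε) with hb_def
  have hsum : n * normTail μ X b = ∑ i ∈ Finset.range n, normTail μ (Y i) b := by
    simp [normTail_eq_of_identDistrib (hident _)]
  have hrate : (n : ℝ) ^ (δ - 1 / p) * b ≤ 1 := by
    rw [hb_def, ← Real.rpow_add hn0]
    exact Real.rpow_le_one_of_one_le_of_nonpos (Nat.one_le_cast.2 hn) (by nlinarith)
  have hexp : Real.exp (((n : ℝ) ^ (δ - 1 / p)) ^ 2 *
        ∑ i ∈ Finset.range n, ∫ ω, ‖truncNorm b (Y i ω)‖ ^ 2 ∂μ -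
        (n : ℝ) ^ (δ - 1 / p) * (s * (n : ℝ) ^ (1 / p))) ≤
      Real.exp (C * 2 / (2 - p) - s * (n : ℝ) ^ δ) := by
    rw [mul_left_comm, ← Real.rpow_add hn0, sub_add_cancel]
    gcongr
    exact sq_rpow_mul_sum_integral_norm_truncNorm_sq_le hident hp0 hp2 htail hδε hn
  rw [hsum] at hsmall ⊢
  refine (measureReal_norm_sum_le (fun i => (hident i).aemeasurable_fst) hind (Finset.range n)
    (by positivity) (by positivity) hrate ?_).trans (add_le_add_right hexp _)
  exact (add_le_add_right hexp _).trans_lt hsmall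

theorem eventually_normTail_partialSum_le (hind : iIndepFun Y μ)
    (hident : ∀ i, IdentDistrib (Y i) X μ μ) (hp0 : 0 < p) (hp2 : p < 2)
    (hwlln : ∀ s, 0 < s →
      Tendsto (fun n : ℕ => normTail μ (partialSum Y n) (s * (n : ℝ) ^ (1 / p))) atTop (𝓝 0))
    {s ε : ℝ} (hs : 0 < s) (hε : 0 < ε) (K : ℝ) :
    ∀ᶠ n : ℕ in atTop, normTail μ (partialSum Y n) (s * (n : ℝ) ^ (1 / p)) ≤
      4 * (n * normTail μ X ((n : ℝ) ^ (1 / p - ε))) + (n : ℝ) ^ K := by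
  obtain ⟨C, htail⟩ := exists_normTail_le_mul_rpow_neg hind hident hp0 hwlln
  have hs3 : 0 < s / 3 := by positivity
  have hδ : 0 < (2 - p) * ε / 2 := half_pos (mul_pos (sub_pos.2 hp2) hε)
  have herror (K' : ℝ) : ∀ᶠ n : ℕ in atTop,
      Real.exp (C * 2 / (2 - p) - s / 3 * (n : ℝ) ^ ((2 - p) * ε / 2)) ≤ (n : ℝ) ^ K' :=
    tendsto_natCast_atTop_atTop.eventually (eventually_exp_sub_mul_rpow_le_rpow hs3 hδ _ K')
  filter_upwards [herror K, herror (-1), eventually_ge_atTop 4,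
    (hwlln (s / 3) hs3).eventually_le_const (by norm_num : (0 : ℝ) < 1 / 4)]
    with n hnK hn_inv hn4 hn_wlln
  have hinv : (n : ℝ) ^ (-1 : ℝ) ≤ 1 / 4 := by
    rw [Real.rpow_neg_one, one_div]
    exact inv_anti₀ (by norm_num) (by exact_mod_cast hn4)
  rcases le_or_gt (n * normTail μ X ((n : ℝ) ^ (1 / p - ε))) (1 / 4) with hsmall | hlarge
  · have hbound := normTail_partialSum_le_add_exp hind hident hp0 hp2 htail hε
      (mul_div_cancel₀ _ two_ne_zero) (by lia : 0 < n) (s := s / 3) (by linarith)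
    rw [← mul_assoc, mul_div_cancel₀ s three_ne_zero] at hbound
    have : 0 ≤ n * normTail μ X ((n : ℝ) ^ (1 / p - ε)) :=
      mul_nonneg (Nat.cast_nonneg n) (normTail_nonneg _)
    linarith
  · have : 0 ≤ (n : ℝ) ^ K := Real.rpow_nonneg (Nat.cast_nonneg n) K
    linarith [normTail_le_one (μ := μ) (X := partialSum Y n) (s * (n : ℝ) ^ (1 / p))]

end UpperBoundUnderWeakLaw

section ChangeOfScale

theorem map_atTop_eq_of_tendsto_of_rightInverse {α β : Type*} [Preorder α] [Preorder β]
    {N : α → β} {τ : β → α} (hN : Tendsto N atTop atTop) (hτ : Tendsto τ atTop atTop)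
    (h : Function.RightInverse τ N) : map N atTop = atTop := by
  refine le_antisymm hN ?_
  calc atTop = map N (map τ atTop) := by rw [map_map, h.comp_eq_id, map_id]
    _ ≤ map N atTop := map_mono hτ

theorem tendsto_div_rpow_atTop {a b : ℝ} (ha : 0 < a) (hb : 0 < b) :
    Tendsto (fun x : ℝ => (x / b) ^ a) atTop atTop :=
  (tendsto_rpow_atTop ha).comp (tendsto_id.atTop_div_const hb)

theorem map_natFloor_div_rpow_atTop {a b : ℝ} (ha : 0 < a) (hb : 0 < b) :
    map (fun x : ℝ => ⌊(x / b) ^ a⌋₊) atTop = atTop := by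
  refine map_atTop_eq_of_tendsto_of_rightInverse (τ := fun n : ℕ => b * (n : ℝ) ^ a⁻¹)
    (tendsto_nat_floor_atTop.comp (tendsto_div_rpow_atTop ha hb))
    (((tendsto_rpow_atTop (inv_pos.2 ha)).comp tendsto_natCast_atTop_atTop).const_mul_atTop hb)
    fun n => ?_
  simp only [mul_div_cancel_left₀ _ hb.ne', Real.rpow_inv_rpow n.cast_nonneg ha.ne',
    Nat.floor_natCast]

theorem isTheta_natFloor_div_rpow_rpow {a b : ℝ} (ha : 0 < a) (hb : 0 < b) (q : ℝ) :
    (fun x : ℝ => (⌊(x / b) ^ a⌋₊ : ℝ) ^ q) =Θ[atTop] fun x => x ^ (a * q) := by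
  have hfloor : (fun x : ℝ => (⌊(x / b) ^ a⌋₊ : ℝ)) =Θ[atTop] fun x => (x / b) ^ a :=
    (Asymptotics.isEquivalent_nat_floor.comp_tendsto (tendsto_div_rpow_atTop ha hb)).isTheta
  have hdiv : (fun x : ℝ => x / b) =Θ[atTop] fun x => x := by
    simpa only [div_eq_inv_mul] using
      (Asymptotics.isTheta_refl _ _).const_mul_left (inv_ne_zero hb.ne')
  have hnonneg : ∀ᶠ x : ℝ in atTop, 0 ≤ x / b :=
    (eventually_ge_atTop 0).mono fun x hx => div_nonneg hx hb.le
  refine (hfloor.rpow (r := q) (.of_forall fun x => Nat.cast_nonneg _)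
    (hnonneg.mono fun x hx => Real.rpow_nonneg hx a)).trans ?_
  have hmul : (fun x : ℝ => ((x / b) ^ a) ^ q) =ᶠ[atTop] fun x => (x / b) ^ (a * q) :=
    hnonneg.mono fun x hx => (Real.rpow_mul hx a q).symm
  exact hmul.trans_isTheta (hdiv.rpow hnonneg (eventually_ge_atTop 0))

theorem isLittleO_rpow_rpow_atTop {a b : ℝ} (hab : a < b) :
    (fun x : ℝ => x ^ a) =o[atTop] fun x => x ^ b := by
  refine (Asymptotics.isLittleO_iff_tendsto' ?_).2 ?_
  · filter_upwards [eventually_gt_atTop 0] with x hx hxb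
    exact absurd hxb (Real.rpow_pos_of_pos hx b).ne'
  · refine (tendsto_rpow_neg_atTop (sub_pos.2 hab)).congr' ?_
    filter_upwards [eventually_gt_atTop 0] with x hx
    rw [neg_sub, Real.rpow_sub hx]

theorem eventually_le_of_isLittleO {f g : ℝ → ℝ} (h : f =o[atTop] g)
    (hg : ∀ᶠ x in atTop, 0 ≤ g x) : ∀ᶠ x in atTop, f x ≤ g x := by
  filter_upwards [h.def one_pos, hg] with x hx hgx
  rw [one_mul, Real.norm_of_nonneg hgx] at hx
  exact (le_abs_self _).trans hx

variable {V : ℝ → ℝ} {P : ℕ → ℝ} {p c c' : ℝ}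

/-- The sample size `N x` is of order `x ^ a` with `a` slightly larger than `p`; the slack in
`c < c'` pays for `p < a`. -/
theorem exists_map_atTop_eq_and_le_rpow_and_add_le_rpow (hp : 0 < p) (hcc : c < c') :
    ∃ ε, 0 < ε ∧ ∃ N : ℝ → ℕ, map N atTop = atTop ∧
      (∀ᶠ x : ℝ in atTop, x ≤ (N x : ℝ) ^ (1 / p - ε)) ∧
      ∀ᶠ x : ℝ in atTop,
        4 * (N x * x ^ (p * (c - 1))) + (N x : ℝ) ^ (c' - 1) ≤ (N x : ℝ) ^ c' := by
  obtain ⟨a, hac, hpa⟩ : ∃ a, a + p * (c - 1) < a * c' ∧ p < a := by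
    have hcont : ∀ᶠ a in 𝓝 p, a + p * (c - 1) < a * c' :=
      ContinuousAt.eventually_lt (by fun_prop) (by fun_prop) (by nlinarith)
    exact ((hcont.filter_mono nhdsWithin_le_nhds).and self_mem_nhdsWithin).exists (f := 𝓝[>] p)
  have ha : 0 < a := hp.trans hpa
  obtain ⟨ε, hε, haε⟩ : ∃ ε, 0 < ε ∧ 1 < a * (1 / p - ε) := by
    refine ⟨(1 / p - 1 / a) / 2, half_pos (sub_pos.2 (one_div_lt_one_div_of_lt hp hpa)), ?_⟩
    have : 1 < a / p := (one_lt_div hp).2 hpa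
    field_simp at this ⊢
    linarith
  obtain ⟨N, hN, hΘ⟩ : ∃ N : ℝ → ℕ, map N atTop = atTop ∧
      ∀ q : ℝ, (fun x => (N x : ℝ) ^ q) =Θ[atTop] fun x => x ^ (a * q) :=
    ⟨_, map_natFloor_div_rpow_atTop ha one_pos, isTheta_natFloor_div_rpow_rpow ha one_pos⟩
  have hmul : (fun x => N x * x ^ (p * (c - 1))) =Θ[atTop] fun x => x ^ (a + p * (c - 1)) := by
    have hN1 := hΘ 1
    simp only [Real.rpow_one, mul_one] at hN1
    refine (hN1.mul (Asymptotics.isTheta_refl _ _)).trans_eventuallyEq ?_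
    filter_upwards [eventually_gt_atTop 0] with x hx using (Real.rpow_add hx _ _).symm
  refine ⟨ε, hε, N, hN, eventually_le_of_isLittleO ?_ (.of_forall fun x => by positivity),
    eventually_le_of_isLittleO (.add (.const_mul_left ?_ 4) ?_)
      (.of_forall fun x => by positivity)⟩
  · simpa only [Real.rpow_one] using (isLittleO_rpow_rpow_atTop haε).trans_isTheta (hΘ _).symm
  · exact (hmul.trans_isLittleO (isLittleO_rpow_rpow_atTop hac)).trans_isTheta (hΘ c').symm
  · exact ((hΘ _).trans_isLittleO (isLittleO_rpow_rpow_atTop (by linarith))).trans_isTheta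
      (hΘ c').symm

theorem exists_map_atTop_eq_and_eventually_le_rpow (hV : Antitone V) (hp : 0 < p)
    (hP : ∀ ε K : ℝ, 0 < ε → ∀ᶠ n : ℕ in atTop,
      P n ≤ 4 * (n * V ((n : ℝ) ^ (1 / p - ε))) + (n : ℝ) ^ K) (hcc : c < c') :
    ∃ N : ℝ → ℕ, map N atTop = atTop ∧
      ∀ᶠ x in atTop, V x ≤ x ^ (p * (c - 1)) → P (N x) ≤ (N x : ℝ) ^ c' := by
  obtain ⟨ε, hε, N, hN, hlevel, hpow⟩ := exists_map_atTop_eq_and_le_rpow_and_add_le_rpow hp hcc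
  refine ⟨N, hN, ?_⟩
  filter_upwards [(tendsto_iff_eventually.1 hN.le) (hP ε (c' - 1) hε), hlevel, hpow]
    with x hPx hx hpow_x hVx
  calc P (N x) ≤ 4 * (N x * V ((N x : ℝ) ^ (1 / p - ε))) + (N x : ℝ) ^ (c' - 1) := hPx
    _ ≤ 4 * (N x * x ^ (p * (c - 1))) + (N x : ℝ) ^ (c' - 1) := by
      gcongr
      exact (hV hx).trans hVx
    _ ≤ (N x : ℝ) ^ c' := hpow_x

theorem eventually_le_rpow_of_natFloor_le_rpow {s : ℝ} (hV : Antitone V) (hp : 0 < p) (hs : 0 < s)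
    (hP : ∀ᶠ n : ℕ in atTop, n * V (s * (n : ℝ) ^ (1 / p)) ≤ 8 * P n) (hcc : c < c') :
    ∀ᶠ x in atTop, P ⌊(x / s) ^ p⌋₊ ≤ (⌊(x / s) ^ p⌋₊ : ℝ) ^ c → V x ≤ x ^ (p * (c' - 1)) := by
  have hN : Tendsto (fun x : ℝ => ⌊(x / s) ^ p⌋₊) atTop atTop :=
    (map_natFloor_div_rpow_atTop hp hs).le
  have hpow : ∀ᶠ x : ℝ in atTop, 8 * (⌊(x / s) ^ p⌋₊ : ℝ) ^ (c - 1) ≤ x ^ (p * (c' - 1)) := by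
    refine eventually_le_of_isLittleO (.const_mul_left ?_ 8) ?_
    · exact (isTheta_natFloor_div_rpow_rpow hp hs _).trans_isLittleO
        (isLittleO_rpow_rpow_atTop (by gcongr))
    · filter_upwards [eventually_ge_atTop 0] with x hx using Real.rpow_nonneg hx _
  filter_upwards [hN.eventually hP, hN.eventually (eventually_gt_atTop 0), hpow,
    eventually_ge_atTop 0] with x hPx hNx hpow_x hx hle
  have hNx0 : (0 : ℝ) < ⌊(x / s) ^ p⌋₊ := Nat.cast_pos.2 hNx
  have hlevel : s * (⌊(x / s) ^ p⌋₊ : ℝ) ^ (1 / p) ≤ x := by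
    rw [mul_comm, ← le_div_iff₀ hs, one_div,
      Real.rpow_inv_le_iff_of_pos hNx0.le (by positivity) hp]
    exact Nat.floor_le (by positivity)
  generalize ⌊(x / s) ^ p⌋₊ = n at *
  calc V x ≤ V (s * (n : ℝ) ^ (1 / p)) := hV hlevel
    _ ≤ 8 * (n : ℝ) ^ c / n := (le_div_iff₀' hNx0).2 (hPx.trans (by gcongr))
    _ = 8 * (n : ℝ) ^ (c - 1) := by rw [Real.rpow_sub_one hNx0.ne', mul_div_assoc]
    _ ≤ x ^ (p * (c' - 1)) := hpow_x

end ChangeOfScale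

section LogarithmicRates

variable {Ω B : Type*} [MeasurableSpace Ω] {μ : Measure Ω} [NormedAddCommGroup B] {X : Ω → B}
  {Y : ℕ → Ω → B} {p s : ℝ}

theorem logTailRate_log_le_coe_iff [IsFiniteMeasure μ] {x c : ℝ} (hx : 1 < x) :
    logTailRate μ X (Real.log x) ≤ c ↔ normTail μ X x ≤ x ^ c := by
  have hset : {ω | Real.log ‖X ω‖ > Real.log x} = {ω | x < ‖X ω‖} := by
    ext ω
    rcases (norm_nonneg (X ω)).eq_or_lt with h | h
    · simp [← h, (Real.log_pos hx).not_gt, (zero_lt_one.trans hx).not_gt]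
    · exact Real.log_lt_log_iff (zero_lt_one.trans hx) h
  rw [logTailRate, hset, one_div_log_mul_log_le_coe_iff hx (measure_ne_top _ _), normTail,
    measureReal_def]

theorem map_logTailRate_atTop :
    map (logTailRate μ X) atTop = map (fun x => logTailRate μ X (Real.log x)) atTop := by
  conv_rhs => rw [← Real.map_exp_atTop, map_map]
  simp only [Function.comp_def, Real.log_exp]

theorem deviationExponent_upperTailExponent (hp : 0 < p) :
    deviationExponent p (upperTailExponent μ X) =
      limsup (fun x => deviationExponent p (-logTailRate μ X (Real.log x))) atTop := by
  rw [upperTailExponent, limsup, map_logTailRate_atTop]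
  exact deviationExponent_neg_limsup hp _

theorem deviationExponent_lowerTailExponent (hp : 0 < p) :
    deviationExponent p (lowerTailExponent μ X) =
      liminf (fun x => deviationExponent p (-logTailRate μ X (Real.log x))) atTop := by
  rw [lowerTailExponent, liminf, map_logTailRate_atTop]
  exact deviationExponent_neg_liminf hp _

theorem deviationExponent_neg_logTailRate_log_le_coe_iff [IsFiniteMeasure μ] (hp : 0 < p)
    {x c : ℝ} (hx : 1 < x) :
    deviationExponent p (-logTailRate μ X (Real.log x)) ≤ c ↔
      normTail μ X x ≤ x ^ (p * (c - 1)) := by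
  rw [deviationExponent_neg_le_coe_iff hp, logTailRate_log_le_coe_iff hx]

theorem logDeviationRate_le_coe_iff [IsFiniteMeasure μ] {n : ℕ} (hn : 1 < n) {c : ℝ} :
    logDeviationRate μ Y p s n ≤ c ↔
      normTail μ (partialSum Y n) (s * (n : ℝ) ^ (1 / p)) ≤ (n : ℝ) ^ c :=
  one_div_log_mul_log_le_coe_iff (Nat.one_lt_cast.2 hn) (measure_ne_top _ _)

end LogarithmicRates

section Main

variable {Ω B : Type*} [MeasurableSpace Ω] {μ : Measure Ω} [IsProbabilityMeasure μ]
  [NormedAddCommGroup B] {X : Ω → B} {Y : ℕ → Ω → B} {p s : ℝ}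

theorem tendsto_normTail_partialSum_of_tendstoInMeasure
    (h : TendstoInMeasure μ (fun (n : ℕ) ω => ((n : ℝ) ^ (1 / p))⁻¹ * ‖partialSum Y n ω‖) atTop
      (fun _ => (0 : ℝ))) (hs : 0 < s) :
    Tendsto (fun n : ℕ => normTail μ (partialSum Y n) (s * (n : ℝ) ^ (1 / p))) atTop (𝓝 0) := by
  refine squeeze_zero' (.of_forall fun n => normTail_nonneg _) ?_
    (tendstoInMeasure_iff_measureReal_norm.1 h s hs)
  filter_upwards [eventually_gt_atTop 0] with n hn
  have hpow : 0 < (n : ℝ) ^ (1 / p) := Real.rpow_pos_of_pos (Nat.cast_pos.2 hn) _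
  refine measureReal_mono fun ω hω => ?_
  simp only [Set.mem_ofPred_eq, sub_zero] at hω ⊢
  rw [Real.norm_of_nonneg (by positivity), le_inv_mul_iff₀ hpow, mul_comm]
  exact hω.le

variable [MeasurableSpace B] [BorelSpace B] [SecondCountableTopology B]

theorem limsup_logDeviationRate_le_and_liminf_logDeviationRate_le (hind : iIndepFun Y μ)
    (hident : ∀ i, IdentDistrib (Y i) X μ μ) (hp0 : 0 < p) (hp2 : p < 2)
    (hwlln : ∀ s, 0 < s →
      Tendsto (fun n : ℕ => normTail μ (partialSum Y n) (s * (n : ℝ) ^ (1 / p))) atTop (𝓝 0))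
    (hs : 0 < s) :
    limsup (logDeviationRate μ Y p s) atTop ≤ deviationExponent p (upperTailExponent μ X) ∧
      liminf (logDeviationRate μ Y p s) atTop ≤ deviationExponent p (lowerTailExponent μ X) := by
  rw [deviationExponent_upperTailExponent hp0, deviationExponent_lowerTailExponent hp0]
  refine limsup_le_limsup_and_liminf_le_liminf fun c c' hcc => ?_
  obtain ⟨N, hN, himp⟩ := exists_map_atTop_eq_and_eventually_le_rpow
    (antitone_normTail (μ := μ) (X := X)) hp0 (fun ε K hε =>
      eventually_normTail_partialSum_le hind hident hp0 hp2 hwlln hs hε K) hcc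
  refine ⟨N, hN, ?_⟩
  filter_upwards [himp, eventually_gt_atTop 1,
    tendsto_iff_eventually.1 hN.le (eventually_gt_atTop 1)] with x hx hx1 hNx
  rwa [deviationExponent_neg_logTailRate_log_le_coe_iff hp0 hx1, logDeviationRate_le_coe_iff hNx]

theorem le_limsup_logDeviationRate_and_le_liminf_logDeviationRate (hind : iIndepFun Y μ)
    (hident : ∀ i, IdentDistrib (Y i) X μ μ) (hp : 0 < p)
    (hwlln : ∀ s, 0 < s →
      Tendsto (fun n : ℕ => normTail μ (partialSum Y n) (s * (n : ℝ) ^ (1 / p))) atTop (𝓝 0))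
    (hs : 0 < s) :
    deviationExponent p (upperTailExponent μ X) ≤ limsup (logDeviationRate μ Y p s) atTop ∧
      deviationExponent p (lowerTailExponent μ X) ≤ liminf (logDeviationRate μ Y p s) atTop := by
  have h2s : 0 < 2 * s := by positivity
  have hN := map_natFloor_div_rpow_atTop hp h2s
  rw [deviationExponent_upperTailExponent hp, deviationExponent_lowerTailExponent hp, ← hN]
  refine limsup_le_limsup_and_liminf_le_liminf (l := atTop) (l' := atTop)
    (u := logDeviationRate μ Y p s ∘ fun x : ℝ => ⌊(x / (2 * s)) ^ p⌋₊)
    fun c c' hcc => ⟨id, map_id, ?_⟩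
  have hP : ∀ᶠ n : ℕ in atTop, n * normTail μ X (2 * s * (n : ℝ) ^ (1 / p)) ≤
      8 * normTail μ (partialSum Y n) (s * (n : ℝ) ^ (1 / p)) := by
    simpa only [mul_assoc] using
      (eventually_mul_normTail_le hind hident hp hwlln hs).mono fun n hn => hn.2
  filter_upwards [eventually_le_rpow_of_natFloor_le_rpow antitone_normTail hp h2s hP hcc,
    eventually_gt_atTop 1, tendsto_iff_eventually.1 hN.le (eventually_gt_atTop 1)] with x hx hx1 hNx
  rwa [id_eq, deviationExponent_neg_logTailRate_log_le_coe_iff hp hx1, Function.comp_apply,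
    logDeviationRate_le_coe_iff hNx]

end Main

theorem theorem2p1_general {B : Type*} [NormedAddCommGroup B]
    [TopologicalSpace.SeparableSpace B] [MeasurableSpace B] [BorelSpace B]
    {Ω : Type*} [MeasurableSpace Ω] (μ : Measure Ω) [IsProbabilityMeasure μ]
    (p : ℝ) (hp0 : 0 < p) (hp2 : p < 2) (X : Ω → B) (Y : ℕ → Ω → B)
    (hindep : iIndepFun Y μ) (hident : ∀ i, IdentDistrib (Y i) X μ μ)
    (hwlln : TendstoInMeasure μ
      (fun (n : ℕ) ω => ((n : ℝ) ^ (1 / p))⁻¹ * ‖partialSum Y n ω‖) atTop (fun _ => (0 : ℝ)))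
    (s : ℝ) (hs : 0 < s) :
    limsup (fun n : ℕ => logDeviationRate μ Y p s n) atTop
        = -(upperTailExponent μ X - (p : EReal)) / (p : EReal) ∧
      liminf (fun n : ℕ => logDeviationRate μ Y p s n) atTop
        = -(lowerTailExponent μ X - (p : EReal)) / (p : EReal) ∧
      ∀ β : EReal,
        Tendsto (fun n : ℕ => logDeviationRate μ Y p s n) atTop
            (𝓝 (-(β - (p : EReal)) / (p : EReal))) ↔
          upperTailExponent μ X = lowerTailExponent μ X ∧ lowerTailExponent μ X = β := by
  have := UniformSpace.secondCountable_of_separable B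
  have htail (r : ℝ) (hr : 0 < r) := tendsto_normTail_partialSum_of_tendstoInMeasure hwlln hr
  have hle :=
    limsup_logDeviationRate_le_and_liminf_logDeviationRate_le hindep hident hp0 hp2 htail hs
  have hge := le_limsup_logDeviationRate_and_le_liminf_logDeviationRate hindep hident hp0 htail hs
  have hlimsup := le_antisymm hle.1 hge.1
  have hliminf := le_antisymm hle.2 hge.2
  refine ⟨hlimsup, hliminf, fun β => ?_⟩
  have hinj := (deviationExponent_strictAnti hp0).injective
  change Tendsto (logDeviationRate μ Y p s) atTop (𝓝 (deviationExponent p β)) ↔ _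
  rw [tendsto_nhds_iff_limsup_eq_and_liminf_eq, hlimsup, hliminf, hinj.eq_iff, hinj.eq_iff]
  exact ⟨fun h => ⟨h.1.trans h.2.symm, h.2⟩, fun h => ⟨h.1.trans h.2, h.2⟩⟩

theorem theorem2p1 {B : Type*} [NormedAddCommGroup B] [NormedSpace ℝ B] [CompleteSpace B]
    [TopologicalSpace.SeparableSpace B] [MeasurableSpace B] [BorelSpace B]
    {Ω : Type*} [MeasurableSpace Ω] (μ : Measure Ω) [IsProbabilityMeasure μ]
    (p : ℝ) (hp0 : 0 < p) (hp2 : p < 2)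
    (X : Ω → B) (Y : ℕ → Ω → B)
    (hindep : iIndepFun Y μ) (hident : ∀ i, IdentDistrib (Y i) X μ μ)
    (hwlln : TendstoInMeasure μ
      (fun (n : ℕ) (ω : Ω) => ((n : ℝ) ^ (1 / p))⁻¹ • partialSum Y n ω) atTop
      (fun _ => (0 : B))) :
    ∀ s : ℝ, 0 < s →
      limsup (fun n : ℕ => logDeviationRate μ Y p s n) atTop
          = -(upperTailExponent μ X - (p : EReal)) / (p : EReal) ∧
      liminf (fun n : ℕ => logDeviationRate μ Y p s n) atTop
          = -(lowerTailExponent μ X - (p : EReal)) / (p : EReal) ∧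
      ∀ β : EReal,
        Tendsto (fun n : ℕ => logDeviationRate μ Y p s n) atTop
            (𝓝 (-(β - (p : EReal)) / (p : EReal))) ↔
          upperTailExponent μ X = lowerTailExponent μ X ∧ lowerTailExponent μ X = β := by
  refine theorem2p1_general μ p hp0 hp2 X Y hindep hident ?_
  simpa [tendstoInMeasure_iff_norm, norm_smul] using hwlln
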